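/- Let $p$ be fixed, and let $(X_i, Y_i)$, $i \ge 1$, be independent, not necessarily identically distributed, random vectors in $\mathbb{R}^p \times \mathbb{R}$ with $\mathbb{E}\left[\|X_i\|_2^6 + Y_i^6\right] \le B < \infty$ for all $i \ge 1$. Put $$\hat\Sigma_n = \frac1n\sum_{i=1}^n X_iX_i^\top,\qquad \Sigma_n = \frac1n\sum_{i=1}^n \mathbb{E}\left[X_iX_i^\top\right],\qquad \Gamma_n = \frac1n\sum_{i=1}^n \mathbb{E}\left[X_iY_i\right],\qquad \beta_n = \Sigma_n^{-1}\Gamma_n,$$ let $\hat\beta_n$ be any least squares estimator, that is, almost surely a minimizer over $\theta\in\mathbb{R}^p$ of $\frac1n\sum_{i=1}^n (Y_i - X_i^\top\theta)^2$, and put $$S_i = S_{i,n} = X_i(Y_i - X_i^\top\beta_n) - \mathbb{E}\left[X_i(Y_i - X_i^\top\beta_n)\right],\qquad K_n = \mathrm{Var}\Big(\frac{1}{\sqrt n}\sum_{i=1}^n S_i\Big).$$ Assume that $\Sigma_n$ and $K_n$ are invertible uniformly in $n$, in the sense that $$\liminf_{n\to\infty}\lambda_{\min}(\Sigma_n) >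 0 \qquad\text{and}\qquad \liminf_{n\to\infty}\lambda_{\min}(K_n) > 0 .$$ Then, as $n\to\infty$, $$\sqrt n\, K_n^{-1/2}\,\hat\Sigma_n\,(\hat\beta_n - \beta_n) \ \xrightarrow{\ \mathcal L\ }\ N(0, I_p),$$ where $K_n^{-1/2}$ is the inverse of the positive semidefinite square root of $K_n$ (defined for all large $n$). -/

import Mathlib

open MeasureTheory ProbabilityTheory Filter Topology
open scoped MatrixOrder

noncomputable section

namespace OLS

variable {Ω : Type*} [MeasurableSpace Ω] {p : ℕ}

/- The observations are indexed by `ℕ`, so that the first `n` of them are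
`(X i, Y i)` with `i ∈ Finset.range n`. -/

/-- The average squared residual `(1/n) ∑_{i<n} (Y_i - X_iᵀ θ)²` at the sample point `ω`. -/
def empiricalRisk (X : ℕ → Ω → EuclideanSpace ℝ (Fin p)) (Y : ℕ → Ω → ℝ) (n : ℕ) (ω : Ω)
    (θ : EuclideanSpace ℝ (Fin p)) : ℝ :=
  (n : ℝ)⁻¹ * ∑ i ∈ Finset.range n, (Y i ω - inner ℝ (X i ω) θ) ^ 2

/-- `b` is a least squares estimate from the first `n` observations at `ω`: it minimizes the
average squared residual over all of `ℝ^p`. -/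
def IsLeastSquares (X : ℕ → Ω → EuclideanSpace ℝ (Fin p)) (Y : ℕ → Ω → ℝ) (n : ℕ) (ω : Ω)
    (b : EuclideanSpace ℝ (Fin p)) : Prop :=
  ∀ θ : EuclideanSpace ℝ (Fin p), empiricalRisk X Y n ω b ≤ empiricalRisk X Y n ω θ

/-- The matrix `(1/n) ∑_{i<n} X_i X_iᵀ` at the sample point `ω`. -/
def sampleGram (X : ℕ → Ω → EuclideanSpace ℝ (Fin p)) (n : ℕ) (ω : Ω) :
    Matrix (Fin p) (Fin p) ℝ :=
  (n : ℝ)⁻¹ • ∑ i ∈ Finset.range n, Matrix.vecMulVec (X i ω).ofLp (X i ω).ofLp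

/-- The matrix `(1/n) ∑_{i<n} E[X_i X_iᵀ]`. -/
def popGram (P : Measure Ω) (X : ℕ → Ω → EuclideanSpace ℝ (Fin p)) (n : ℕ) :
    Matrix (Fin p) (Fin p) ℝ :=
  (n : ℝ)⁻¹ • ∑ i ∈ Finset.range n, Matrix.of fun j k => ∫ ω, X i ω j * X i ω k ∂P

/-- The vector `(1/n) ∑_{i<n} E[X_i Y_i]`. -/
def popCross (P : Measure Ω) (X : ℕ → Ω → EuclideanSpace ℝ (Fin p)) (Y : ℕ → Ω → ℝ) (n : ℕ) :
    Fin p → ℝ :=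
  (n : ℝ)⁻¹ • ∑ i ∈ Finset.range n, fun j => ∫ ω, X i ω j * Y i ω ∂P

/-- The least squares target for sample size `n`: the inverse of `popGram` times `popCross`. -/
def target (P : Measure Ω) (X : ℕ → Ω → EuclideanSpace ℝ (Fin p)) (Y : ℕ → Ω → ℝ) (n : ℕ) :
    EuclideanSpace ℝ (Fin p) :=
  WithLp.toLp 2 ((popGram P X n)⁻¹.mulVec (popCross P X Y n))

/-- The centered score `S_i = X_i (Y_i - X_iᵀ β_n) - E[X_i (Y_i - X_iᵀ β_n)]`, where `β_n` is the
target for sample size `n`. -/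
def score (P : Measure Ω) (X : ℕ → Ω → EuclideanSpace ℝ (Fin p)) (Y : ℕ → Ω → ℝ) (n i : ℕ)
    (ω : Ω) : EuclideanSpace ℝ (Fin p) :=
  (Y i ω - inner ℝ (X i ω) (target P X Y n)) • X i ω
    - ∫ ω', (Y i ω' - inner ℝ (X i ω') (target P X Y n)) • X i ω' ∂P

/-- The covariance matrix of a random vector. -/
def covMat (P : Measure Ω) (W : Ω → EuclideanSpace ℝ (Fin p)) : Matrix (Fin p) (Fin p) ℝ :=
  Matrix.of fun j k => cov[fun ω => W ω j, fun ω => W ω k; P]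

/-- The matrix `K_n`: the covariance matrix of `n^{-1/2} ∑_{i<n} S_i`. -/
def scoreCov (P : Measure Ω) (X : ℕ → Ω → EuclideanSpace ℝ (Fin p)) (Y : ℕ → Ω → ℝ) (n : ℕ) :
    Matrix (Fin p) (Fin p) ℝ :=
  covMat P fun ω => (√(n : ℝ))⁻¹ • ∑ i ∈ Finset.range n, score P X Y n i ω

/-- The inverse of the positive semidefinite square root of a matrix. -/
def invSqrt (K : Matrix (Fin p) (Fin p) ℝ) : Matrix (Fin p) (Fin p) ℝ :=
  (CFC.sqrt K)⁻¹

/-- The smallest eigenvalues of the symmetric matrices `M n` are eventually bounded below by a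
positive constant: for some `c > 0`, the matrix `M n - c I` is positive semidefinite for all
large `n`. -/
def UniformlyPosDef (M : ℕ → Matrix (Fin p) (Fin p) ℝ) : Prop :=
  ∃ c : ℝ, 0 < c ∧ ∀ᶠ n in atTop, (M n - c • (1 : Matrix (Fin p) (Fin p) ℝ)).PosSemidef

/-- The normalized estimation error: `√n`, times the inverse square root of `K_n`, times
the sample Gram matrix, times `b n ω` minus the target. -/
def normalizedError (P : Measure Ω) (X : ℕ → Ω → EuclideanSpace ℝ (Fin p)) (Y : ℕ → Ω → ℝ)
    (b : ℕ → Ω → EuclideanSpace ℝ (Fin p)) (n : ℕ) (ω : Ω) : EuclideanSpace ℝ (Fin p) :=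
  √(n : ℝ) • WithLp.toLp 2
    ((invSqrt (scoreCov P X Y n) * sampleGram X n ω).mulVec (b n ω - target P X Y n).ofLp)

end OLS

end

/-!
The least squares estimator enters the normalized error only through the normal equations
(`OLS.IsLeastSquares.sum_residual_smul_eq_zero`): multiplying `b - β_n` by the sample Gram matrix
leaves `n⁻¹ ∑ (Y_i - X_iᵀ β_n) X_i`, whichever minimizer `b` was chosen. Once the population Gram
matrix is invertible, the population normal equations
(`OLS.sum_integral_residual_smul_target_eq_zero`) make the sum of the expectations of these terms
vanish, so that the normalized error equals almost surely
`K_n^{-1/2} n^{-1/2} ∑ S_i`, a standardized row sum of independent centered vectors.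

The claim is then a Lyapunov central limit theorem for triangular arrays
(`OLS.tendstoInDistribution_standardized_sum`), proved with characteristic functions and Lévy's
convergence theorem. At a frequency `t`, put `a = K_n^{-1/2} t`. The scalar sum
`n^{-1/2} ∑ ⟪S_i, a⟫` has variance exactly `‖t‖²`, and `‖a‖² ≤ ‖t‖² / c` if `K_n ≥ c I`. Comparing
each factor of the characteristic function with the Gaussian factor of the same variance costs a
third absolute moment and a squared second moment
(`ProbabilityTheory.iIndepFun.norm_charFun_map_sum_one_sub_exp_le`), and the total error is of
order `n^{-1/2}`.

The third moments of the scores are bounded uniformly because the scores are quadratic in the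
observations, whose sixth moments are bounded, and because the targets `β_n` stay bounded:
`c ‖β‖² ≤ βᵀ Σ_n β = βᵀ Γ_n ≤ ‖β‖ (1 + B)` (`OLS.norm_target_le`).
-/

/-! ### Second-order expansion of the exponential -/

lemma norm_cexp_mul_I_sub_taylor_two_le (x : ℝ) :
    ‖Complex.exp (x * Complex.I) - (1 + x * Complex.I - x ^ 2 / 2)‖ ≤ 4 * |x| ^ 3 := by
  rcases le_total |x| 1 with h | h
  · have hx : ‖(x : ℂ) * Complex.I‖ = |x| := by simp
    have := Complex.exp_bound (x := x * Complex.I) (by rw [hx]; exact h) (n := 3) (by norm_num)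
    rw [hx] at this
    have e : ∑ m ∈ Finset.range 3, ((x : ℂ) * Complex.I) ^ m / (m.factorial : ℂ)
        = 1 + x * Complex.I - x ^ 2 / 2 := by
      simp [Finset.sum_range_succ, mul_pow, Complex.I_sq]
      ring
    rw [e] at this
    refine this.trans ?_
    rw [mul_comm]
    refine mul_le_mul_of_nonneg_right ?_ (by positivity)
    norm_num [Nat.factorial]
  · have h1 : ‖Complex.exp (x * Complex.I)‖ = 1 := Complex.norm_exp_ofReal_mul_I x
    have h2 : ‖(1 + x * Complex.I - x ^ 2 / 2 : ℂ)‖ ≤ 1 + |x| + |x| ^ 2 / 2 := by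
      refine (norm_sub_le _ _).trans (add_le_add ((norm_add_le _ _).trans ?_) ?_) <;> simp
    have h3 : |x| ≤ |x| ^ 3 := le_self_pow₀ h (by norm_num)
    have h4 : |x| ^ 2 ≤ |x| ^ 3 := pow_le_pow_right₀ h (by norm_num)
    refine (norm_sub_le _ _).trans ?_
    linarith

lemma Real.abs_exp_neg_sub_le_sq {s : ℝ} (hs : 0 ≤ s) :
    |Real.exp (-s) - (1 - s)| ≤ s ^ 2 := by
  rcases le_total s 1 with h | h
  · have := Real.abs_exp_sub_one_sub_id_le (x := -s) (by rw [abs_neg, abs_of_nonneg hs]; exact h)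
    rw [neg_sq] at this
    convert! this using 2
    ring
  · have h1 : Real.exp (-s) ≤ 1 := Real.exp_le_one_iff.2 (by linarith)
    rw [abs_of_nonneg (by linarith [Real.exp_pos (-s)])]
    nlinarith

lemma Finset.norm_prod_sub_prod_le {ι R : Type*} [NormedCommRing R] [NormOneClass R]
    (s : Finset ι) {f g : ι → R}
    (hf : ∀ i ∈ s, ‖f i‖ ≤ 1) (hg : ∀ i ∈ s, ‖g i‖ ≤ 1) :
    ‖∏ i ∈ s, f i - ∏ i ∈ s, g i‖ ≤ ∑ i ∈ s, ‖f i - g i‖ := by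
  classical
  induction s using Finset.induction_on with
  | empty => simp
  | insert a s ha ih =>
    have hf' : ∀ i ∈ s, ‖f i‖ ≤ 1 := fun i hi => hf i (Finset.mem_insert_of_mem hi)
    have hg' : ∀ i ∈ s, ‖g i‖ ≤ 1 := fun i hi => hg i (Finset.mem_insert_of_mem hi)
    rw [Finset.prod_insert ha, Finset.prod_insert ha, Finset.sum_insert ha]
    have e : f a * ∏ i ∈ s, f i - g a * ∏ i ∈ s, g i
        = (f a - g a) * ∏ i ∈ s, f i + g a * (∏ i ∈ s, f i - ∏ i ∈ s, g i) := by ring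
    have hp : ‖∏ i ∈ s, f i‖ ≤ 1 :=
      (Finset.norm_prod_le s f).trans (Finset.prod_le_one (fun _ _ => norm_nonneg _) hf')
    rw [e]
    refine (norm_add_le _ _).trans (add_le_add ?_ ?_)
    · exact (norm_mul_le _ _).trans (mul_le_of_le_one_right (norm_nonneg _) hp)
    · refine (norm_mul_le _ _).trans ?_
      exact (mul_le_of_le_one_left (norm_nonneg _) (hg a (Finset.mem_insert_self _ _))).trans
        (ih hf' hg')

/-! ### Characteristic functions of sums of independent variables -/

section CharFun

variable {Ω : Type*} [MeasurableSpace Ω] {P : Measure Ω} [IsProbabilityMeasure P]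

/-- Both the characteristic function at `1` and the Gaussian factor are compared with the common
second-order expansion `1 - v / 2`, where `v` is the variance. -/
lemma ProbabilityTheory.norm_charFun_map_one_sub_exp_le {W : Ω → ℝ} (hW : MemLp W 3 P)
    (h0 : ∫ ω, W ω ∂P = 0) :
    ‖charFun (P.map W) 1 - (Real.exp (-((∫ ω, W ω ^ 2 ∂P) / 2)) : ℂ)‖
      ≤ 4 * ∫ ω, |W ω| ^ 3 ∂P + (∫ ω, W ω ^ 2 ∂P) ^ 2 := by
  have hm : AEMeasurable W P := hW.aestronglyMeasurable.aemeasurable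
  have i3 : Integrable (fun ω => |W ω| ^ 3) P := by
    simpa using hW.integrable_norm_pow (p := 3) (by norm_num)
  have i2 : Integrable (fun ω => W ω ^ 2) P :=
    (hW.mono_exponent (p := 2) (by norm_num)).integrable_sq
  have i1 : Integrable W P := hW.integrable (by norm_num)
  have ie : Integrable (fun ω => Complex.exp (W ω * Complex.I)) P := by
    refine Integrable.of_bound (C := 1) ?_ (.of_forall fun ω => ?_)
    · exact (Complex.continuous_exp.comp (by fun_prop : Continuous fun x : ℝ =>
        (x : ℂ) * Complex.I)).comp_aestronglyMeasurable hW.aestronglyMeasurable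
    · exact (Complex.norm_exp_ofReal_mul_I _).le
  have i2' : Integrable (fun ω => (W ω : ℂ) ^ 2 / 2) P := by
    simpa using (i2.div_const 2).ofReal (𝕜 := ℂ)
  have i1' : Integrable (fun ω => (1 + W ω * Complex.I : ℂ)) P :=
    (integrable_const _).add (i1.ofReal.mul_const _)
  have ip : Integrable (fun ω => (1 + W ω * Complex.I - W ω ^ 2 / 2 : ℂ)) P := by
    exact i1'.sub i2'
  have hc : charFun (P.map W) 1 = ∫ ω, Complex.exp (W ω * Complex.I) ∂P := by
    rw [charFun_apply_real, integral_map hm]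
    · simp
    · exact Continuous.aestronglyMeasurable (by fun_prop)
  have hp : ∫ ω, (1 + W ω * Complex.I - W ω ^ 2 / 2 : ℂ) ∂P
      = 1 - ((∫ ω, W ω ^ 2 ∂P : ℝ) : ℂ) / 2 := by
    have e2 : ∫ ω, (W ω ^ 2 / 2 : ℂ) ∂P = ((∫ ω, W ω ^ 2 ∂P : ℝ) : ℂ) / 2 := by
      rw [integral_div, ← integral_complex_ofReal]
      simp
    rw [integral_sub i1' i2', e2,
      integral_add (integrable_const _) (i1.ofReal.mul_const _), integral_mul_const,
      integral_complex_ofReal, h0]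
    simp
  set v : ℝ := ∫ ω, W ω ^ 2 ∂P with hv
  have hv0 : 0 ≤ v := integral_nonneg fun ω => sq_nonneg _
  have b1 : ‖charFun (P.map W) 1 - (1 - (v : ℂ) / 2)‖ ≤ 4 * ∫ ω, |W ω| ^ 3 ∂P := by
    rw [hc, ← hp, ← integral_sub ie ip, ← integral_const_mul]
    exact norm_integral_le_of_norm_le (i3.const_mul 4)
      (.of_forall fun ω => norm_cexp_mul_I_sub_taylor_two_le (W ω))
  have b2 : ‖(1 - (v : ℂ) / 2) - (Real.exp (-(v / 2)) : ℂ)‖ ≤ v ^ 2 := by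
    have e : (1 - (v : ℂ) / 2) - (Real.exp (-(v / 2)) : ℂ)
        = (((1 - v / 2) - Real.exp (-(v / 2)) : ℝ) : ℂ) := by push_cast; ring
    rw [e, Complex.norm_real, Real.norm_eq_abs, abs_sub_comm]
    have := Real.abs_exp_neg_sub_le_sq (s := v / 2) (by linarith)
    nlinarith [sq_nonneg v]
  calc _ = ‖(charFun (P.map W) 1 - (1 - (v : ℂ) / 2))
        + ((1 - (v : ℂ) / 2) - (Real.exp (-(v / 2)) : ℂ))‖ := by congr 1; ring
    _ ≤ _ := (norm_add_le _ _).trans (add_le_add b1 b2)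

/-- Quantitative Lyapunov estimate: the characteristic function at `1` of a sum of independent
centered variables is close to that of a Gaussian with the same variance. -/
lemma ProbabilityTheory.iIndepFun.norm_charFun_map_sum_one_sub_exp_le {W : ℕ → Ω → ℝ}
    (hindep : iIndepFun W P) (hW : ∀ i, MemLp (W i) 3 P) (h0 : ∀ i, ∫ ω, W i ω ∂P = 0) (n : ℕ) :
    ‖charFun (P.map fun ω => ∑ i ∈ Finset.range n, W i ω) 1
        - (Real.exp (-(Var[fun ω => ∑ i ∈ Finset.range n, W i ω; P] / 2)) : ℂ)‖
      ≤ ∑ i ∈ Finset.range n, (4 * ∫ ω, |W i ω| ^ 3 ∂P + (∫ ω, W i ω ^ 2 ∂P) ^ 2) := by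
  have hm i : AEMeasurable (W i) P := (hW i).aestronglyMeasurable.aemeasurable
  have hvar : Var[fun ω => ∑ i ∈ Finset.range n, W i ω; P]
      = ∑ i ∈ Finset.range n, ∫ ω, W i ω ^ 2 ∂P := by
    have := IndepFun.variance_sum (μ := P) (X := W) (s := Finset.range n)
      (fun i _ => (hW i).mono_exponent (by norm_num))
      (fun i _ j _ hij => hindep.indepFun hij)
    rw [show (fun ω => ∑ i ∈ Finset.range n, W i ω) = ∑ i ∈ Finset.range n, W i by ext; simp, this]
    exact Finset.sum_congr rfl fun i _ => variance_of_integral_eq_zero (hm i) (h0 i)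
  rw [(hindep.restrict _).charFun_map_fun_finsetSum_eq_prod (fun _ _ ↦ hm _), hvar,
    Finset.sum_div, ← Finset.sum_neg_distrib, Real.exp_sum, Complex.ofReal_prod, Finset.prod_apply]
  refine (Finset.norm_prod_sub_prod_le _ (fun i _ => ?_) (fun i _ => ?_)).trans
    (Finset.sum_le_sum fun i _ => norm_charFun_map_one_sub_exp_le (hW i) (h0 i))
  · have := Measure.isProbabilityMeasure_map (hm i)
    exact norm_charFun_le_one _
  · rw [Complex.norm_real, Real.norm_eq_abs, Real.abs_exp, Real.exp_le_one_iff]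
    have : 0 ≤ ∫ ω, W i ω ^ 2 ∂P := integral_nonneg fun ω => sq_nonneg _
    linarith

end CharFun

namespace OLS

/-! ### Inverse square roots and covariance matrices -/

variable {Ω : Type*} [MeasurableSpace Ω] {P : Measure Ω} {p : ℕ}

/-- The eigenvalue bound `K ≥ c I` as coercivity of the quadratic form of `K`. -/
lemma norm_sq_le_of_posSemidef_sub {K : Matrix (Fin p) (Fin p) ℝ} {c : ℝ}
    (hK : (K - c • (1 : Matrix (Fin p) (Fin p) ℝ)).PosSemidef) (a : EuclideanSpace ℝ (Fin p)) :
    c * ‖a‖ ^ 2 ≤ a.ofLp ⬝ᵥ K.mulVec a.ofLp := by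
  have := hK.dotProduct_mulVec_nonneg a.ofLp
  rw [star_trivial, Matrix.sub_mulVec, dotProduct_sub, Matrix.smul_mulVec, Matrix.one_mulVec,
    dotProduct_smul, smul_eq_mul] at this
  have h : a.ofLp ⬝ᵥ a.ofLp = ‖a‖ ^ 2 := by
    rw [EuclideanSpace.real_norm_sq_eq]; simp [dotProduct, sq]
  rw [h] at this
  linarith

lemma posDef_of_posSemidef_sub {K : Matrix (Fin p) (Fin p) ℝ} {c : ℝ} (hc : 0 < c)
    (hK : (K - c • (1 : Matrix (Fin p) (Fin p) ℝ)).PosSemidef) : K.PosDef := by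
  simpa using Matrix.PosDef.posSemidef_add hK (Matrix.PosDef.one.smul hc)

lemma isSymm_invSqrt (K : Matrix (Fin p) (Fin p) ℝ) : (invSqrt K).transpose = invSqrt K := by
  have h : (CFC.sqrt K).IsHermitian := (Matrix.nonneg_iff_posSemidef.1 (CFC.sqrt_nonneg K)).1
  have := h.inv
  rwa [Matrix.IsHermitian, Matrix.conjTranspose_eq_transpose_of_trivial] at this

lemma invSqrt_mul_mul_invSqrt {K : Matrix (Fin p) (Fin p) ℝ} (hK : K.PosDef) :
    invSqrt K * K * invSqrt K = 1 := by
  have h0 : 0 ≤ K := Matrix.nonneg_iff_posSemidef.2 hK.posSemidef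
  have hs : CFC.sqrt K * CFC.sqrt K = K := CFC.sqrt_mul_sqrt_self K h0
  have hu : IsUnit (CFC.sqrt K).det :=
    (Matrix.isUnit_iff_isUnit_det _).1 ((CFC.isUnit_sqrt_iff K h0).2 hK.isUnit)
  nth_rw 2 [← hs]
  rw [invSqrt, ← mul_assoc, Matrix.nonsing_inv_mul _ hu, one_mul, Matrix.mul_nonsing_inv _ hu]

lemma inner_toLp_invSqrt_mulVec (K : Matrix (Fin p) (Fin p) ℝ) (w t : EuclideanSpace ℝ (Fin p)) :
    inner ℝ (WithLp.toLp 2 ((invSqrt K).mulVec w.ofLp) : EuclideanSpace ℝ (Fin p)) t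
      = inner ℝ w (WithLp.toLp 2 ((invSqrt K).mulVec t.ofLp) : EuclideanSpace ℝ (Fin p)) := by
  simp only [EuclideanSpace.inner_eq_star_dotProduct, star_trivial]
  rw [Matrix.dotProduct_mulVec, ← Matrix.mulVec_transpose, isSymm_invSqrt, dotProduct_comm]

lemma variance_inner_eq [IsFiniteMeasure P] {W : Ω → EuclideanSpace ℝ (Fin p)} (hW : MemLp W 2 P)
    (a : EuclideanSpace ℝ (Fin p)) :
    Var[fun ω => inner ℝ (W ω) a; P] = a.ofLp ⬝ᵥ (covMat P W).mulVec a.ofLp := by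
  have h : (fun ω => inner ℝ (W ω) a) = fun ω => ∑ j, a j * W ω j := by
    ext ω; simp [PiLp.inner_apply]
  rw [h, variance_fun_sum fun j => (hW.eval_piLp j).const_mul _]
  simp only [covariance_const_mul_left, covariance_const_mul_right, dotProduct, Matrix.mulVec,
    covMat, Matrix.of_apply, Finset.mul_sum]
  refine Finset.sum_congr rfl fun i _ => Finset.sum_congr rfl fun j _ => by ring

lemma memLp_smul_finsetSum {E : Type*} [NormedAddCommGroup E] [NormedSpace ℝ E] {V : ℕ → Ω → E}
    {q : ENNReal} (hV : ∀ i, MemLp (V i) q P) (r : ℝ) (s : Finset ℕ) :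
    MemLp (fun ω => r • ∑ i ∈ s, V i ω) q P := by
  have h : MemLp (fun ω => ∑ i ∈ s, V i ω) q P := memLp_finsetSum s fun i _ => hV i
  exact h.const_smul r

lemma aemeasurable_toLp_mulVec {W : Ω → EuclideanSpace ℝ (Fin p)} (hW : AEMeasurable W P)
    (M : Matrix (Fin p) (Fin p) ℝ) :
    AEMeasurable (fun ω => (WithLp.toLp 2 (M.mulVec (W ω).ofLp) : EuclideanSpace ℝ (Fin p))) P := by
  have hc : Continuous fun w : EuclideanSpace ℝ (Fin p) =>
      (WithLp.toLp 2 (M.mulVec w.ofLp) : EuclideanSpace ℝ (Fin p)) := by fun_prop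
  exact hc.measurable.comp_aemeasurable hW

/-! ### The Lyapunov central limit theorem -/

variable [IsProbabilityMeasure P]

/-- The Gaussian approximation of the standardized sum at a fixed frequency `t`, with an error
of order `n^{-1/2}` in terms of a third moment bound `C` and an eigenvalue bound `c`. -/
lemma norm_charFun_standardized_sub_le {S : ℕ → Ω → EuclideanSpace ℝ (Fin p)}
    (hindep : iIndepFun S P) (hS : ∀ i, MemLp (S i) 3 P) (h0 : ∀ i, ∫ ω, S i ω ∂P = 0)
    {C : ℝ} (hC : ∀ i, ∫ ω, ‖S i ω‖ ^ 3 ∂P ≤ C) {n : ℕ} (hn : 0 < n)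
    {K : Matrix (Fin p) (Fin p) ℝ}
    (hKdef : K = covMat P fun ω => (√(n : ℝ))⁻¹ • ∑ i ∈ Finset.range n, S i ω) {c : ℝ} (hc : 0 < c)
    (hK : (K - c • (1 : Matrix (Fin p) (Fin p) ℝ)).PosSemidef) (t : EuclideanSpace ℝ (Fin p)) :
    ‖charFun (P.map fun ω => (WithLp.toLp 2 ((invSqrt K).mulVec
        ((√(n : ℝ))⁻¹ • ∑ i ∈ Finset.range n, S i ω).ofLp) : EuclideanSpace ℝ (Fin p))) t
        - Complex.exp (-‖t‖ ^ 2 / 2)‖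
      ≤ 4 * √(‖t‖ ^ 2 / c) ^ 3 * C * (√(n : ℝ))⁻¹ + (‖t‖ ^ 2 / c * (1 + C)) ^ 2 * (n : ℝ)⁻¹ := by
  set a : EuclideanSpace ℝ (Fin p) := WithLp.toLp 2 ((invSqrt K).mulVec t.ofLp) with ha
  set W : ℕ → Ω → ℝ := fun i ω => (√(n : ℝ))⁻¹ * inner ℝ (S i ω) a with hW
  have hn' : (0 : ℝ) < n := by exact_mod_cast hn
  have hsum ω : inner ℝ ((√(n : ℝ))⁻¹ • ∑ i ∈ Finset.range n, S i ω) a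
      = ∑ i ∈ Finset.range n, W i ω := by
    rw [real_inner_smul_left, sum_inner, Finset.mul_sum]
  have hTL : MemLp (fun ω => (√(n : ℝ))⁻¹ • ∑ i ∈ Finset.range n, S i ω) 2 P :=
    memLp_smul_finsetSum (fun i => (hS i).mono_exponent (by norm_num)) _ _
  have hTm := hTL.aestronglyMeasurable.aemeasurable
  have hWL i : MemLp (W i) 3 P := ((hS i).inner_const a).const_mul _
  -- Since `K^{-1/2} K K^{-1/2} = I`, the row sum in direction `a` has variance `‖t‖²`.
  have hquad : a.ofLp ⬝ᵥ K.mulVec a.ofLp = ‖t‖ ^ 2 := by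
    have e : K.mulVec a.ofLp = (K * invSqrt K).mulVec t.ofLp := by simp [ha, Matrix.mulVec_mulVec]
    rw [e]
    have e2 : a.ofLp = Matrix.vecMul t.ofLp (invSqrt K) := by
      rw [← Matrix.mulVec_transpose, isSymm_invSqrt]
    rw [e2, ← Matrix.dotProduct_mulVec, Matrix.mulVec_mulVec, ← mul_assoc,
      invSqrt_mul_mul_invSqrt (posDef_of_posSemidef_sub hc hK), Matrix.one_mulVec,
      EuclideanSpace.real_norm_sq_eq]
    simp [dotProduct, sq]
  have hvar : Var[fun ω => ∑ i ∈ Finset.range n, W i ω; P] = ‖t‖ ^ 2 := by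
    rw [← hquad, hKdef, ← variance_inner_eq hTL]
    exact congrArg (variance · P) (funext fun ω => (hsum ω).symm)
  have hchar : charFun (P.map fun ω => (WithLp.toLp 2 ((invSqrt K).mulVec
        ((√(n : ℝ))⁻¹ • ∑ i ∈ Finset.range n, S i ω).ofLp) : EuclideanSpace ℝ (Fin p))) t
      = charFun (P.map fun ω => ∑ i ∈ Finset.range n, W i ω) 1 := by
    rw [charFun_apply, integral_map (aemeasurable_toLp_mulVec hTm _)
      (Continuous.aestronglyMeasurable (by fun_prop)), charFun_apply_real, integral_map
        (Finset.aemeasurable_fun_sum _ fun i _ => (hWL i).aestronglyMeasurable.aemeasurable)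
        (Continuous.aestronglyMeasurable (by fun_prop))]
    refine integral_congr_ae (.of_forall fun ω => ?_)
    simp only [inner_toLp_invSqrt_mulVec]
    rw [← hsum ω]
    simp [ha]
  have hWind : iIndepFun W P := hindep.comp (fun _ s => (√(n : ℝ))⁻¹ * inner ℝ s a)
    fun _ => by fun_prop
  have hW0 i : ∫ ω, W i ω ∂P = 0 := by
    have hi : Integrable (S i) P := (hS i).integrable (by norm_num)
    have := integral_inner (𝕜 := ℝ) hi a
    simp only [h0 i, inner_zero_right] at this
    simp only [hW, integral_const_mul]
    simp_rw [real_inner_comm a] at this ⊢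
    simp [this]
  have hmain := iIndepFun.norm_charFun_map_sum_one_sub_exp_le hWind hWL hW0 n
  rw [hchar]
  rw [hvar] at hmain
  have hexp : ((Real.exp (-(‖t‖ ^ 2 / 2)) : ℝ) : ℂ) = Complex.exp (-‖t‖ ^ 2 / 2) := by
    push_cast; congr 1; ring
  rw [hexp] at hmain
  refine hmain.trans ?_
  set A := √(‖t‖ ^ 2 / c)
  have hA0 : 0 ≤ A := Real.sqrt_nonneg _
  have hA2 : A ^ 2 = ‖t‖ ^ 2 / c := Real.sq_sqrt (by positivity)
  -- Coercivity of `K` bounds the direction `a` by its variance, uniformly in `n`.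
  have haA : ‖a‖ ≤ A := by
    refine Real.le_sqrt_of_sq_le ?_
    rw [le_div_iff₀ hc, mul_comm, ← hquad]
    exact norm_sq_le_of_posSemidef_sub hK a
  set r := (√(n : ℝ))⁻¹ with hr
  have hr0 : 0 ≤ r := by positivity
  have hr2 : r ^ 2 = (n : ℝ)⁻¹ := by rw [hr, inv_pow, Real.sq_sqrt hn'.le]
  have hnr : (n : ℝ) * r ^ 2 = 1 := by rw [hr2, mul_inv_cancel₀ hn'.ne']
  have hWb i ω : |W i ω| ≤ r * A * ‖S i ω‖ := by
    rw [hW, abs_mul, abs_of_nonneg hr0, mul_assoc]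
    refine mul_le_mul_of_nonneg_left ?_ hr0
    refine (abs_real_inner_le_norm _ _).trans ?_
    rw [mul_comm]
    exact mul_le_mul_of_nonneg_right haA (norm_nonneg _)
  have i3 i : Integrable (fun ω => ‖S i ω‖ ^ 3) P := by
    simpa using (hS i).integrable_norm_pow (p := 3) (by norm_num)
  have b3 i : ∫ ω, |W i ω| ^ 3 ∂P ≤ (r * A) ^ 3 * C := by
    refine le_trans ?_ (mul_le_mul_of_nonneg_left (hC i) (by positivity))
    rw [← integral_const_mul]
    refine integral_mono_of_nonneg (.of_forall fun ω => by positivity) ((i3 i).const_mul _)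
      (.of_forall fun ω => ?_)
    dsimp only
    rw [← mul_pow]
    exact pow_le_pow_left₀ (abs_nonneg _) (hWb i ω) 3
  have b2 i : ∫ ω, W i ω ^ 2 ∂P ≤ (r * A) ^ 2 * (1 + C) := by
    have e : ∫ ω, (1 + ‖S i ω‖ ^ 3) ∂P = 1 + ∫ ω, ‖S i ω‖ ^ 3 ∂P := by
      rw [integral_add (integrable_const _) (i3 i)]; simp
    refine le_trans ?_ (mul_le_mul_of_nonneg_left (add_le_add_right (hC i) 1) (by positivity))
    rw [← e, ← integral_const_mul]
    refine integral_mono_of_nonneg (.of_forall fun ω => by positivity)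
      (((integrable_const _).add (i3 i)).const_mul _) (.of_forall fun ω => ?_)
    dsimp only
    rw [← sq_abs]
    refine (pow_le_pow_left₀ (abs_nonneg _) (hWb i ω) 2).trans ?_
    rw [mul_pow]
    refine mul_le_mul_of_nonneg_left ?_ (by positivity)
    rcases le_total ‖S i ω‖ 1 with h | h
    · have := pow_le_one₀ (n := 2) (norm_nonneg _) h
      have : 0 ≤ ‖S i ω‖ ^ 3 := by positivity
      linarith
    · have := pow_le_pow_right₀ h (show 2 ≤ 3 by norm_num)
      linarith
  have hb i : 4 * ∫ ω, |W i ω| ^ 3 ∂P + (∫ ω, W i ω ^ 2 ∂P) ^ 2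
      ≤ 4 * ((r * A) ^ 3 * C) + ((r * A) ^ 2 * (1 + C)) ^ 2 := by
    have h := b3 i
    have h' := pow_le_pow_left₀ (integral_nonneg fun ω => sq_nonneg (W i ω)) (b2 i) 2
    linarith
  refine (Finset.sum_le_sum fun i _ => hb i).trans (le_of_eq ?_)
  rw [Finset.sum_const, Finset.card_range, nsmul_eq_mul, ← hA2, ← hr2]
  linear_combination (4 * r * A ^ 3 * C + r ^ 2 * A ^ 4 * (1 + C) ^ 2) * hnr

lemma tendstoInDistribution_congr_eventually {E Ω' : Type*} [TopologicalSpace E]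
    [MeasurableSpace E] [OpensMeasurableSpace E] [MeasurableSpace Ω'] {Q : Measure Ω'}
    [IsProbabilityMeasure Q] {T U : ℕ → Ω → E} {Z : Ω' → E}
    (hT : TendstoInDistribution T atTop Z (fun _ => P) Q) (hU : ∀ n, AEMeasurable (U n) P)
    (hTU : ∀ᶠ n in atTop, T n =ᵐ[P] U n) :
    TendstoInDistribution U atTop Z (fun _ => P) Q where
  forall_aemeasurable := hU
  aemeasurable_limit := hT.aemeasurable_limit
  tendsto := by
    refine hT.tendsto.congr' ?_
    filter_upwards [hTU] with n hn
    exact Subtype.ext (Measure.map_congr hn)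

/-- Lyapunov's central limit theorem for the row sums of a triangular array of independent
centered random vectors with bounded third moments and uniformly invertible covariances. -/
theorem tendstoInDistribution_standardized_sum {S : ℕ → ℕ → Ω → EuclideanSpace ℝ (Fin p)}
    (hindep : ∀ n, iIndepFun (S n) P) (hS : ∀ n i, MemLp (S n i) 3 P)
    (h0 : ∀ n i, ∫ ω, S n i ω ∂P = 0) {C : ℝ}
    (hC : ∀ᶠ n in atTop, ∀ i, ∫ ω, ‖S n i ω‖ ^ 3 ∂P ≤ C)
    {K : ℕ → Matrix (Fin p) (Fin p) ℝ}
    (hKdef : ∀ n, K n = covMat P fun ω => (√(n : ℝ))⁻¹ • ∑ i ∈ Finset.range n, S n i ω)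
    (hK : UniformlyPosDef K) :
    TendstoInDistribution (fun (n : ℕ) ω => (WithLp.toLp 2 ((invSqrt (K n)).mulVec
        ((√(n : ℝ))⁻¹ • ∑ i ∈ Finset.range n, S n i ω).ofLp) : EuclideanSpace ℝ (Fin p))) atTop
      (id : EuclideanSpace ℝ (Fin p) → EuclideanSpace ℝ (Fin p)) (fun _ => P)
      (multivariateGaussian 0 (1 : Matrix (Fin p) (Fin p) ℝ)) where
  forall_aemeasurable n := aemeasurable_toLp_mulVec
    (memLp_smul_finsetSum (hS n) _ _).aestronglyMeasurable.aemeasurable _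
  tendsto := by
    refine ProbabilityMeasure.tendsto_iff_tendsto_charFun.2 fun t => ?_
    obtain ⟨c, hc, hK⟩ := hK
    simp only [ProbabilityMeasure.coe_mk, Measure.map_id, multivariateGaussian_zero_one,
      charFun_stdGaussian]
    have hr : Tendsto (fun n : ℕ => (√(n : ℝ))⁻¹) atTop (𝓝 0) :=
      tendsto_inv_atTop_zero.comp (Real.tendsto_sqrt_atTop.comp tendsto_natCast_atTop_atTop)
    have hlim := (hr.const_mul (4 * √(‖t‖ ^ 2 / c) ^ 3 * C)).add
      (tendsto_inv_atTop_nhds_zero_nat (𝕜 := ℝ) |>.const_mul ((‖t‖ ^ 2 / c * (1 + C)) ^ 2))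
    rw [mul_zero, mul_zero, add_zero] at hlim
    refine tendsto_iff_norm_sub_tendsto_zero.2
      (squeeze_zero' (.of_forall fun n => norm_nonneg _) ?_ hlim)
    filter_upwards [hC, hK, eventually_gt_atTop 0] with n hCn hKn hn
    exact norm_charFun_standardized_sub_le (hindep n) (hS n) (h0 n) hCn hn (hKdef n) hc hKn t

end OLS

namespace OLS

/-! ### The normal equations -/

variable {Ω : Type*} {p : ℕ}

/-- The normal equations: the residuals of a least squares fit are orthogonal to the regressors.
The minimality inequality is used only along the line through `b` in the direction of the
vector that has to vanish. -/
lemma IsLeastSquares.sum_residual_smul_eq_zero {X : ℕ → Ω → EuclideanSpace ℝ (Fin p)}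
    {Y : ℕ → Ω → ℝ} {n : ℕ} {ω : Ω} {b : EuclideanSpace ℝ (Fin p)}
    (h : IsLeastSquares X Y n ω b) :
    ∑ i ∈ Finset.range n, (Y i ω - inner ℝ (X i ω) b) • X i ω = 0 := by
  rcases Nat.eq_zero_or_pos n with rfl | hn
  · simp
  set u := ∑ i ∈ Finset.range n, (Y i ω - inner ℝ (X i ω) b) • X i ω with hu
  set Q := ∑ i ∈ Finset.range n, (inner ℝ (X i ω) u) ^ 2 with hQ
  have hQ0 : 0 ≤ Q := Finset.sum_nonneg fun _ _ => sq_nonneg _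
  have hN : ∑ i ∈ Finset.range n, (Y i ω - inner ℝ (X i ω) b) * inner ℝ (X i ω) u = ‖u‖ ^ 2 := by
    rw [← real_inner_self_eq_norm_sq]
    nth_rw 2 [hu]
    rw [sum_inner]
    simp only [real_inner_smul_left]
  have key (s : ℝ) : 2 * s * ‖u‖ ^ 2 ≤ s ^ 2 * Q := by
    have h1 := h (b + s • u)
    have hn' : (0 : ℝ) < (n : ℝ)⁻¹ := by positivity
    rw [empiricalRisk, empiricalRisk, mul_le_mul_iff_right₀ hn'] at h1
    have h2 : ∑ i ∈ Finset.range n, (Y i ω - inner ℝ (X i ω) (b + s • u)) ^ 2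
        = ∑ i ∈ Finset.range n, (Y i ω - inner ℝ (X i ω) b) ^ 2 - 2 * s * ‖u‖ ^ 2 + s ^ 2 * Q := by
      rw [← hN, hQ, Finset.mul_sum, Finset.mul_sum, ← Finset.sum_sub_distrib,
        ← Finset.sum_add_distrib]
      refine Finset.sum_congr rfl fun i _ => ?_
      rw [inner_add_right, real_inner_smul_right]
      ring
    linarith
  -- The quadratic `s ↦ s² Q - 2 s ‖u‖²` is nonnegative; `Q + 1` avoids dividing by `Q = 0`.
  have h3 := key (‖u‖ ^ 2 / (Q + 1))
  have h4 : ‖u‖ ^ 2 = (‖u‖ ^ 2 / (Q + 1)) * (Q + 1) := by field_simp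
  set s := ‖u‖ ^ 2 / (Q + 1)
  rw [h4] at h3
  have h5 : s = 0 := by
    have : 0 ≤ s ^ 2 * Q := by positivity
    nlinarith [sq_nonneg s]
  rw [h5, zero_mul] at h4
  simpa using h4

lemma sampleGram_mulVec (X : ℕ → Ω → EuclideanSpace ℝ (Fin p)) (n : ℕ) (ω : Ω)
    (v : EuclideanSpace ℝ (Fin p)) :
    (sampleGram X n ω).mulVec v.ofLp
      = ((n : ℝ)⁻¹ • ∑ i ∈ Finset.range n, inner ℝ (X i ω) v • X i ω).ofLp := by
  rw [sampleGram, Matrix.smul_mulVec, Matrix.sum_mulVec, WithLp.ofLp_smul, WithLp.ofLp_sum]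
  congr 1
  refine Finset.sum_congr rfl fun i _ => ?_
  ext j
  simp [Matrix.vecMulVec_mulVec, PiLp.inner_apply, dotProduct, mul_comm]

variable [MeasurableSpace Ω] {P : Measure Ω}

/-- By the normal equations the normalized error does not involve the estimator: it is the
normalized sum of the residuals of the target times the regressors. -/
lemma normalizedError_eq {X : ℕ → Ω → EuclideanSpace ℝ (Fin p)}
    {Y : ℕ → Ω → ℝ} {b : ℕ → Ω → EuclideanSpace ℝ (Fin p)} {n : ℕ} {ω : Ω}
    (h : IsLeastSquares X Y n ω (b n ω)) :
    normalizedError P X Y b n ω = WithLp.toLp 2 ((invSqrt (scoreCov P X Y n)).mulVec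
      ((√(n : ℝ))⁻¹ • ∑ i ∈ Finset.range n,
        (Y i ω - inner ℝ (X i ω) (target P X Y n)) • X i ω).ofLp) := by
  have h1 : ∑ i ∈ Finset.range n, inner ℝ (X i ω) (b n ω - target P X Y n) • X i ω
      = ∑ i ∈ Finset.range n, (Y i ω - inner ℝ (X i ω) (target P X Y n)) • X i ω := by
    rw [← sub_eq_zero, ← Finset.sum_sub_distrib, ← neg_eq_zero, ← Finset.sum_neg_distrib]
    refine Eq.trans (Finset.sum_congr rfl fun i _ => ?_) h.sum_residual_smul_eq_zero
    rw [← sub_smul, ← neg_smul, inner_sub_right]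
    congr 1
    ring
  rw [normalizedError, ← Matrix.mulVec_mulVec, sampleGram_mulVec, h1, WithLp.ofLp_smul,
    WithLp.ofLp_smul, Matrix.mulVec_smul, Matrix.mulVec_smul, ← WithLp.toLp_smul, smul_smul]
  congr 3
  -- `√n * n⁻¹ = (√n)⁻¹` also holds for `n = 0`, where both sides are zero.
  rw [← div_eq_mul_inv, Real.sqrt_div_self]

/-! ### Moment bounds -/

lemma mul_abs_le_one_add_pow_six {x : ℝ} (hx : 0 ≤ x) (y : ℝ) :
    x * |y| ≤ 1 + (x ^ 6 + y ^ 6) := by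
  have h6 : y ^ 6 = |y| ^ 6 := (Even.pow_abs (by decide) y).symm
  have hy := abs_nonneg y
  rw [h6]
  have aux (a : ℝ) (ha : 0 ≤ a) : a * a ≤ 1 + a ^ 6 := by
    rcases le_total a 1 with h | h
    · have : 0 ≤ a ^ 6 := by positivity
      nlinarith
    · have := pow_le_pow_right₀ h (show 2 ≤ 6 by norm_num)
      nlinarith
  have px : 0 ≤ x ^ 6 := by positivity
  have py : 0 ≤ |y| ^ 6 := by positivity
  rcases le_total x |y| with h | h
  · linarith [mul_le_mul_of_nonneg_right h hy, aux |y| hy]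
  · linarith [mul_le_mul_of_nonneg_left h hx, aux x hx]

/-- The score is quadratic in the observation, so its third power is controlled by sixth powers:
with `m = max ‖x‖ |y|` the left side is at most `((1 + ‖b‖) m²)³`. -/
lemma norm_sub_inner_smul_pow_three_le {E : Type*} [NormedAddCommGroup E] [InnerProductSpace ℝ E]
    (x b : E) (y : ℝ) :
    ‖(y - inner ℝ x b) • x‖ ^ 3 ≤ (1 + ‖b‖) ^ 3 * (‖x‖ ^ 6 + y ^ 6) := by
  set m := max ‖x‖ |y| with hm
  have hm0 : 0 ≤ m := le_max_of_le_left (norm_nonneg _)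
  have hx : ‖x‖ ≤ m := le_max_left _ _
  have hy : |y| ≤ m := le_max_right _ _
  have h1 : ‖(y - inner ℝ x b) • x‖ ≤ (1 + ‖b‖) * m ^ 2 := by
    rw [norm_smul, Real.norm_eq_abs]
    have h2 : |y - inner ℝ x b| ≤ (1 + ‖b‖) * m := by
      refine (abs_sub _ _).trans ?_
      have := (abs_real_inner_le_norm x b).trans (mul_le_mul_of_nonneg_right hx (norm_nonneg b))
      linarith
    calc _ ≤ ((1 + ‖b‖) * m) * m := mul_le_mul h2 hx (norm_nonneg _) (by positivity)
      _ = _ := by ring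
  have h6 : m ^ 6 ≤ ‖x‖ ^ 6 + y ^ 6 := by
    have e : y ^ 6 = |y| ^ 6 := (Even.pow_abs (by decide) y).symm
    have p1 : 0 ≤ ‖x‖ ^ 6 := by positivity
    have p2 : 0 ≤ |y| ^ 6 := by positivity
    rw [e]
    rcases max_choice ‖x‖ |y| with h | h <;> rw [hm, h] <;> linarith
  calc _ ≤ ((1 + ‖b‖) * m ^ 2) ^ 3 := pow_le_pow_left₀ (norm_nonneg _) h1 3
    _ = (1 + ‖b‖) ^ 3 * m ^ 6 := by ring
    _ ≤ _ := mul_le_mul_of_nonneg_left h6 (by positivity)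

lemma integral_norm_sub_integral_pow_three_le [IsProbabilityMeasure P] {E : Type*}
    [NormedAddCommGroup E] [NormedSpace ℝ E] {V : Ω → E} (hV : MemLp V 3 P) {D : ℝ}
    (hD : ∫ ω, ‖V ω‖ ^ 3 ∂P ≤ D) :
    ∫ ω, ‖V ω - ∫ ω', V ω' ∂P‖ ^ 3 ∂P ≤ 4 * (D + (1 + D) ^ 3) := by
  have i3 : Integrable (fun ω => ‖V ω‖ ^ 3) P := by
    simpa using hV.integrable_norm_pow (p := 3) (by norm_num)
  have hm : ‖∫ ω', V ω' ∂P‖ ≤ 1 + D := by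
    have e : ∫ ω, (1 + ‖V ω‖ ^ 3) ∂P = 1 + ∫ ω, ‖V ω‖ ^ 3 ∂P := by
      rw [integral_add (integrable_const _) i3]; simp
    have := norm_integral_le_of_norm_le ((integrable_const 1).add i3)
      (f := V) (μ := P) (.of_forall fun ω => by
        dsimp only [Pi.add_apply]
        rcases le_total ‖V ω‖ 1 with h | h
        · have : 0 ≤ ‖V ω‖ ^ 3 := by positivity
          linarith
        · have := le_self_pow₀ h (show 3 ≠ 0 by norm_num)
          linarith)
    simp only [Pi.add_apply] at this
    linarith
  have e : ∫ ω, 4 * (‖V ω‖ ^ 3 + (1 + D) ^ 3) ∂P = 4 * (∫ ω, ‖V ω‖ ^ 3 ∂P + (1 + D) ^ 3) := by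
    rw [integral_const_mul, integral_add i3 (integrable_const _)]; simp
  refine le_trans (integral_mono_of_nonneg (.of_forall fun ω => by positivity)
    ((i3.add (integrable_const _)).const_mul 4) (.of_forall fun ω => ?_))
    (e.le.trans (by linarith))
  have h1 := pow_le_pow_left₀ (norm_nonneg _) (norm_sub_le (V ω) (∫ ω', V ω' ∂P)) 3
  have h2 := add_pow_le (norm_nonneg (V ω)) (norm_nonneg (∫ ω', V ω' ∂P)) 3
  have h3 := pow_le_pow_left₀ (norm_nonneg _) hm 3
  norm_num at h2
  dsimp only [Pi.add_apply]
  linarith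

section Observation

variable {x : Ω → EuclideanSpace ℝ (Fin p)} {y : Ω → ℝ}

lemma memLp_residual_smul (hx : AEMeasurable x P) (hy : AEMeasurable y P)
    (hint : Integrable (fun ω => ‖x ω‖ ^ 6 + y ω ^ 6) P) (b : EuclideanSpace ℝ (Fin p)) :
    MemLp (fun ω => (y ω - inner ℝ (x ω) b) • x ω) 3 P := by
  have hm : AEStronglyMeasurable (fun ω => (y ω - inner ℝ (x ω) b) • x ω) P :=
    ((hy.sub (hx.inner_const (c := b))).smul hx).aestronglyMeasurable
  refine (integrable_norm_rpow_iff hm (by norm_num) (by norm_num)).1 ?_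
  refine Integrable.mono' (hint.const_mul ((1 + ‖b‖) ^ 3)) ?_ (.of_forall fun ω => ?_)
  · exact (hm.norm.aemeasurable.pow_const _).aestronglyMeasurable
  · have := norm_sub_inner_smul_pow_three_le (x ω) b (y ω)
    rw [Real.norm_of_nonneg (by positivity)]
    norm_num
    exact_mod_cast this

lemma integral_norm_residual_smul_pow_three_le
    (hint : Integrable (fun ω => ‖x ω‖ ^ 6 + y ω ^ 6) P) {B : ℝ}
    (hB : ∫ ω, (‖x ω‖ ^ 6 + y ω ^ 6) ∂P ≤ B) {b : EuclideanSpace ℝ (Fin p)} {R : ℝ}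
    (hb : ‖b‖ ≤ R) :
    ∫ ω, ‖(y ω - inner ℝ (x ω) b) • x ω‖ ^ 3 ∂P ≤ (1 + R) ^ 3 * B := by
  have h0 : 0 ≤ ∫ ω, (‖x ω‖ ^ 6 + y ω ^ 6) ∂P := integral_nonneg fun ω => by positivity
  calc _ ≤ ∫ ω, (1 + ‖b‖) ^ 3 * (‖x ω‖ ^ 6 + y ω ^ 6) ∂P :=
        integral_mono_of_nonneg (.of_forall fun ω => by positivity) (hint.const_mul _)
          (.of_forall fun ω => norm_sub_inner_smul_pow_three_le _ _ _)
    _ = (1 + ‖b‖) ^ 3 * ∫ ω, (‖x ω‖ ^ 6 + y ω ^ 6) ∂P := integral_const_mul _ _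
    _ ≤ _ := mul_le_mul (pow_le_pow_left₀ (by positivity) (by linarith) 3) hB h0
        (pow_nonneg (by linarith [norm_nonneg b]) 3)

lemma integrable_coord_mul_coord [IsFiniteMeasure P] (hx : AEMeasurable x P)
    (hint : Integrable (fun ω => ‖x ω‖ ^ 6 + y ω ^ 6) P) (j k : Fin p) :
    Integrable (fun ω => x ω j * x ω k) P := by
  have hc (j : Fin p) : AEMeasurable (fun ω => x ω j) P :=
    (by fun_prop : Continuous fun v : EuclideanSpace ℝ (Fin p) => v j).measurable.comp_aemeasurable
      hx
  refine Integrable.mono' (((integrable_const (1 : ℝ)).add hint).const_mul 2)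
    ((hc j).mul (hc k)).aestronglyMeasurable (.of_forall fun ω => ?_)
  have h1 := PiLp.norm_apply_le (x ω) j
  have h2 := PiLp.norm_apply_le (x ω) k
  have h3 := mul_abs_le_one_add_pow_six (norm_nonneg (x ω)) ‖x ω‖
  rw [abs_norm] at h3
  rw [norm_mul]
  have h4 := mul_le_mul h1 h2 (norm_nonneg _) (norm_nonneg (x ω))
  have h5 : 0 ≤ y ω ^ 6 := by positivity
  dsimp only [Pi.add_apply]
  linarith

lemma integrable_coord_mul [IsFiniteMeasure P] (hx : AEMeasurable x P) (hy : AEMeasurable y P)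
    (hint : Integrable (fun ω => ‖x ω‖ ^ 6 + y ω ^ 6) P) (j : Fin p) :
    Integrable (fun ω => x ω j * y ω) P := by
  have hc : AEMeasurable (fun ω => x ω j) P :=
    (by fun_prop : Continuous fun v : EuclideanSpace ℝ (Fin p) => v j).measurable.comp_aemeasurable
      hx
  refine Integrable.mono' ((integrable_const (1 : ℝ)).add hint)
    (hc.mul hy).aestronglyMeasurable (.of_forall fun ω => ?_)
  have h1 := PiLp.norm_apply_le (x ω) j
  have h3 := mul_abs_le_one_add_pow_six (norm_nonneg (x ω)) (y ω)
  rw [norm_mul]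
  exact (mul_le_mul_of_nonneg_right h1 (norm_nonneg _)).trans h3

end Observation

/-! ### The target -/

lemma popGram_mulVec_target {X : ℕ → Ω → EuclideanSpace ℝ (Fin p)} {Y : ℕ → Ω → ℝ} {n : ℕ}
    (h : (popGram P X n).PosDef) :
    (popGram P X n).mulVec (target P X Y n).ofLp = popCross P X Y n := by
  rw [target, Matrix.mulVec_mulVec, Matrix.mul_nonsing_inv _
    ((Matrix.isUnit_iff_isUnit_det _).1 h.isUnit), Matrix.one_mulVec]

/-- The population normal equations: the centerings of the scores add up to zero. They need an
invertible Gram matrix, since otherwise `target` is a junk value. -/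
lemma sum_integral_residual_smul_target_eq_zero [IsProbabilityMeasure P]
    {X : ℕ → Ω → EuclideanSpace ℝ (Fin p)} {Y : ℕ → Ω → ℝ} {n : ℕ}
    (hX : ∀ i, AEMeasurable (X i) P) (hY : ∀ i, AEMeasurable (Y i) P)
    (hint : ∀ i, Integrable (fun ω => ‖X i ω‖ ^ 6 + Y i ω ^ 6) P) (h : (popGram P X n).PosDef) :
    ∑ i ∈ Finset.range n, ∫ ω, (Y i ω - inner ℝ (X i ω) (target P X Y n)) • X i ω ∂P = 0 := by
  rcases Nat.eq_zero_or_pos n with rfl | hn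
  · simp
  have hn' : (n : ℝ)⁻¹ ≠ 0 := by positivity
  set β := target P X Y n
  have hβ := popGram_mulVec_target (Y := Y) h
  ext j
  have hj := congrFun hβ j
  simp only [popGram, popCross, Matrix.smul_mulVec, Pi.smul_apply, smul_eq_mul] at hj
  have hj := mul_left_cancel₀ hn' hj
  rw [Matrix.sum_mulVec, Finset.sum_apply, Finset.sum_apply] at hj
  rw [WithLp.ofLp_sum, Finset.sum_apply, PiLp.zero_apply, ← sub_eq_zero.2 hj.symm,
    ← Finset.sum_sub_distrib]
  refine Finset.sum_congr rfl fun i _ => ?_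
  rw [eval_integral_piLp fun k => ((memLp_residual_smul (hX i) (hY i) (hint i) β).integrable
    (by norm_num)).eval_piLp k]
  have e ω : ((Y i ω - inner ℝ (X i ω) β) • X i ω) j
      = X i ω j * Y i ω - ∑ k, (X i ω j * X i ω k) * β k := by
    simp only [PiLp.smul_apply, smul_eq_mul, PiLp.inner_apply, RCLike.inner_apply, conj_trivial,
      sub_mul, Finset.sum_mul]
    congr 1
    · ring
    · exact Finset.sum_congr rfl fun k _ => by ring
  simp only [e]
  have hk k : Integrable (fun ω => (X i ω j * X i ω k) * β k) P :=
    (integrable_coord_mul_coord (hX i) (hint i) j k).mul_const _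
  rw [integral_sub (integrable_coord_mul (hX i) (hY i) (hint i) j)
    (integrable_finsetSum _ fun k _ => hk k), integral_finsetSum _ fun k _ => hk k]
  simp only [integral_mul_const, Matrix.mulVec, dotProduct, Matrix.of_apply]
  rfl

/-- Coercivity of the Gram matrix turns the moment bound on `X Y` into a bound on the target. -/
lemma norm_target_le [IsProbabilityMeasure P] {X : ℕ → Ω → EuclideanSpace ℝ (Fin p)}
    {Y : ℕ → Ω → ℝ} {n : ℕ} (hX : ∀ i, AEMeasurable (X i) P) (hY : ∀ i, AEMeasurable (Y i) P)
    (hint : ∀ i, Integrable (fun ω => ‖X i ω‖ ^ 6 + Y i ω ^ 6) P) {B : ℝ}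
    (hB : ∀ i, ∫ ω, (‖X i ω‖ ^ 6 + Y i ω ^ 6) ∂P ≤ B) {c : ℝ} (hc : 0 < c)
    (h : (popGram P X n - c • (1 : Matrix (Fin p) (Fin p) ℝ)).PosSemidef) :
    ‖target P X Y n‖ ≤ (1 + B) / c := by
  have hB0 : 0 ≤ B := le_trans (integral_nonneg fun ω => by positivity) (hB 0)
  set β := target P X Y n with hβ
  have h1 := norm_sq_le_of_posSemidef_sub h β
  rw [popGram_mulVec_target (posDef_of_posSemidef_sub hc h)] at h1
  have h2 i : ∑ j, β j * ∫ ω, X i ω j * Y i ω ∂P ≤ ‖β‖ * (1 + B) := by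
    have e : ∑ j, β j * ∫ ω, X i ω j * Y i ω ∂P = ∫ ω, inner ℝ (X i ω) β * Y i ω ∂P := by
      simp only [← integral_const_mul]
      rw [← integral_finsetSum _ fun j _ =>
        (integrable_coord_mul (hX i) (hY i) (hint i) j).const_mul _]
      refine integral_congr_ae (.of_forall fun ω => ?_)
      simp only [PiLp.inner_apply, RCLike.inner_apply, conj_trivial, Finset.sum_mul]
      exact Finset.sum_congr rfl fun k _ => by ring
    have e1 : ∫ ω, (1 + (‖X i ω‖ ^ 6 + Y i ω ^ 6)) ∂P
        = 1 + ∫ ω, (‖X i ω‖ ^ 6 + Y i ω ^ 6) ∂P := by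
      rw [integral_add (integrable_const _) (hint i)]; simp
    rw [e]
    refine (le_abs_self _).trans ?_
    rw [← Real.norm_eq_abs]
    refine (norm_integral_le_of_norm_le (((integrable_const (1 : ℝ)).add (hint i)).const_mul ‖β‖)
      (.of_forall fun ω => ?_)).trans ?_
    · rw [norm_mul]
      refine (mul_le_mul_of_nonneg_right (norm_inner_le_norm _ _) (norm_nonneg _)).trans ?_
      have := mul_le_mul_of_nonneg_left (mul_abs_le_one_add_pow_six (norm_nonneg (X i ω)) (Y i ω))
        (norm_nonneg β)
      simp only [Pi.add_apply, Real.norm_eq_abs]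
      linarith
    · simp only [Pi.add_apply]
      rw [integral_const_mul, e1]
      exact mul_le_mul_of_nonneg_left (by linarith [hB i]) (norm_nonneg _)
  have h3 : β.ofLp ⬝ᵥ popCross P X Y n ≤ ‖β‖ * (1 + B) := by
    rw [popCross, dotProduct_smul, dotProduct_sum, smul_eq_mul]
    have h4 : ∑ i ∈ Finset.range n, (β.ofLp ⬝ᵥ fun j => ∫ ω, X i ω j * Y i ω ∂P)
        ≤ n * (‖β‖ * (1 + B)) := by
      refine (Finset.sum_le_sum fun i _ => h2 i).trans_eq ?_
      rw [Finset.sum_const, Finset.card_range, nsmul_eq_mul]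
    exact inv_mul_le_of_le_mul₀ (by positivity) (by positivity) h4
  rw [le_div_iff₀ hc]
  rcases (norm_nonneg β).eq_or_lt with h0 | h0
  · rw [← h0, zero_mul]; linarith
  · refine le_of_mul_le_mul_left ?_ h0
    linarith

end OLS

/-! ### Asymptotic normality -/

theorem mainTheorem3 {Ω : Type*} [MeasurableSpace Ω] (P : Measure Ω) [IsProbabilityMeasure P]
    (p : ℕ) (X : ℕ → Ω → EuclideanSpace ℝ (Fin p)) (Y : ℕ → Ω → ℝ)
    (hX : ∀ i, AEMeasurable (X i) P) (hY : ∀ i, AEMeasurable (Y i) P)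
    (hindep : iIndepFun (fun i ω => (X i ω, Y i ω)) P)
    (B : ℝ)
    (hint : ∀ i, Integrable (fun ω => ‖X i ω‖ ^ 6 + Y i ω ^ 6) P)
    (hB : ∀ i, ∫ ω, (‖X i ω‖ ^ 6 + Y i ω ^ 6) ∂P ≤ B)
    (hSigma : OLS.UniformlyPosDef (fun n => OLS.popGram P X n))
    (hK : OLS.UniformlyPosDef (fun n => OLS.scoreCov P X Y n))
    (betaHat : ℕ → Ω → EuclideanSpace ℝ (Fin p))
    (hbetaHat : ∀ n, ∀ᵐ ω ∂P, OLS.IsLeastSquares X Y n ω (betaHat n ω)) :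
    TendstoInDistribution (OLS.normalizedError P X Y betaHat) atTop
      (id : EuclideanSpace ℝ (Fin p) → EuclideanSpace ℝ (Fin p)) (fun _ => P)
      (multivariateGaussian 0 (1 : Matrix (Fin p) (Fin p) ℝ)) := by
  obtain ⟨c, hc, hSigma⟩ := hSigma
  have hV n i : MemLp (fun ω => (Y i ω - inner ℝ (X i ω) (OLS.target P X Y n)) • X i ω) 3 P :=
    OLS.memLp_residual_smul (hX i) (hY i) (hint i) _
  have hVi n i := (hV n i).integrable (by norm_num)
  have hS n i : MemLp (OLS.score P X Y n i) 3 P := (hV n i).sub (memLp_const _)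
  have hS0 n i : ∫ ω, OLS.score P X Y n i ω ∂P = 0 := by
    simp only [OLS.score]
    rw [integral_sub (hVi n i) (integrable_const _)]
    simp
  have hSind n : iIndepFun (OLS.score P X Y n) P :=
    hindep.comp (fun i (z : EuclideanSpace ℝ (Fin p) × ℝ) =>
      (z.2 - inner ℝ z.1 (OLS.target P X Y n)) • z.1
        - ∫ ω', (Y i ω' - inner ℝ (X i ω') (OLS.target P X Y n)) • X i ω' ∂P)
      fun i => by fun_prop
  set D := (1 + (1 + B) / c) ^ 3 * B
  have hSC : ∀ᶠ n in atTop, ∀ i,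
      ∫ ω, ‖OLS.score P X Y n i ω‖ ^ 3 ∂P ≤ 4 * (D + (1 + D) ^ 3) := by
    filter_upwards [hSigma] with n hn i
    exact OLS.integral_norm_sub_integral_pow_three_le (hV n i)
      (OLS.integral_norm_residual_smul_pow_three_le (hint i) (hB i)
        (OLS.norm_target_le hX hY hint hB hc hn))
  have hclt := OLS.tendstoInDistribution_standardized_sum hSind hS hS0 hSC
    (K := OLS.scoreCov P X Y) (fun n => rfl) hK
  have heq n : OLS.normalizedError P X Y betaHat n =ᵐ[P]
      fun ω => WithLp.toLp 2 ((OLS.invSqrt (OLS.scoreCov P X Y n)).mulVec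
        ((√(n : ℝ))⁻¹ • ∑ i ∈ Finset.range n,
          (Y i ω - inner ℝ (X i ω) (OLS.target P X Y n)) • X i ω).ofLp) := by
    filter_upwards [hbetaHat n] with ω hω using OLS.normalizedError_eq hω
  refine OLS.tendstoInDistribution_congr_eventually hclt (fun n => ?_) ?_
  -- The estimator need not be measurable; measurability comes from the estimator-free expression.
  · refine AEMeasurable.congr ?_ (heq n).symm
    exact OLS.aemeasurable_toLp_mulVec
      (OLS.memLp_smul_finsetSum (hV n) _ _).aestronglyMeasurable.aemeasurable _
  · filter_upwards [hSigma] with n hn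
    refine Filter.EventuallyEq.trans (.of_forall fun ω => ?_) (heq n).symm
    simp only [OLS.score, Finset.sum_sub_distrib,
      OLS.sum_integral_residual_smul_target_eq_zero hX hY hint
        (OLS.posDef_of_posSemidef_sub hc hn), sub_zero]
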